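/- All Hilbert spaces are finite-dimensional with fixed computational bases, and logarithms are to base $2$. For an operator $X$ on a bipartite space, $X^\Gamma=(\mathrm{id}\otimes T)(X)$ is its partial transpose; a state (density operator) $\rho$ is PPT if $\rho^\Gamma\ge 0$. Put $S(\rho)=-\mathrm{Tr}\,\rho\log\rho$, $D(\rho\|\sigma)=\mathrm{Tr}(\rho\log\rho-\rho\log\sigma)$ (with value $+\infty$ if the support of $\rho$ is not contained in that of $\sigma$), and $G(\rho_{XY})=\log|XY|-S(\rho_{XY})$ (global purity), where $|XY|$ is the dimension of the system $XY$; $\|X\|_1=\mathrm{Tr}\sqrt{X^\dagger X}$. *Operations.* $\mathrm{CLODCC}(A:C:B)$ is the class of maps between operators on tripartite systems generated, under finite composition and under pointwise limits (so that infinite compositions are included), by (i) unitaries applied locally by $A$, $C$ and $B$ (possibly re-factorising the local space), and (ii) sending a subsystem $M$ of one party to another party through a channel that completely dephases $M$ in its computational basis. No ancillas may be added and no subsystem may be discarded. *Target states.* A local idit at $A$ with $m=\log d$ bits is a state of the form $$\alpha_m=\sum_{i,j=0}^{d-1}\frac1d\,|i\rangle\langle j|_K\otimes U_i\,\sigma_{A'B'}\,U_j^\dagger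 ,$$ where $d\ge 1$ is an integer, $\sigma_{A'B'}$ is a state, the $U_i$ are unitaries on $A'B'$, party $A$ holds $KA'$ and party $B$ holds $B'$. *Rate.* For states $\rho_{AC_1}$ and $\tilde\rho_{C_2B}$, with $C=C_1C_2$ held by one party, the repeated private randomness rate localised at $A$ is $$\mathcal R_A^{A\leftrightarrow C\leftrightarrow B}(\rho\otimes\tilde\rho)=\inf_{\epsilon>0}\ \limsup_{n\to\infty}\ \sup\Big\{\tfrac mn:\ \big\|\mathrm{Tr}_C\,\Lambda\big((\rho\otimes\tilde\rho)^{\otimes n}\big)-\alpha_m\big\|_1\le\epsilon\Big\},$$ the supremum being over all $\Lambda\in\mathrm{CLODCC}(A:C:B)$ (acting on the $n$-copy system) and all local idits $\alpha_m$ at $A$ on the resulting system $AB$. **Statement.** For all PPT states $\rho_{AC_1}$ and $\tilde\rho_{C_2B}$, $$\mathcal R_A^{A\leftrightarrow C\leftrightarrow B}(\rho\otimes\tilde\rho)\ \le\ D\Big(\rho^\Gamma\Big\|\tfrac{\mathbb I}{|AC_1|}\Big)+D\Big(\tilde\rho^\Gamma\Big\|\tfrac{\mathbb I}{|C_2B|}\Big).$$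 Equivalently, $\mathcal R_A^{A\leftrightarrow C\leftrightarrow B}(\rho\otimes\tilde\rho)\le G(\rho^\Gamma)+G(\tilde\rho^\Gamma)$, since the two right-hand sides are equal. -/

import Mathlib

open Filter Topology
open scoped Kronecker ComplexOrder

noncomputable section

namespace PrivateRandomness

/-! ### States, partial transposition, entropies -/

section States

variable {n : Type} [Fintype n] [DecidableEq n]

/-- Density operators. -/
def IsState (ρ : Matrix n n ℂ) : Prop := ρ.PosSemidef ∧ ρ.trace = 1

/-- The partial transposition `id ⊗ T` on a bipartite system. -/
def partialTranspose {X Y : Type} (ρ : Matrix (X × Y) (X × Y) ℂ) : Matrix (X × Y) (X × Y) ℂ :=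
  Matrix.of fun p q => ρ (p.1, q.2) (q.1, p.2)

/-- States with positive partial transposition. -/
def IsPPTState {X Y : Type} [Fintype X] [Fintype Y] (ρ : Matrix (X × Y) (X × Y) ℂ) : Prop :=
  IsState ρ ∧ (partialTranspose ρ).PosSemidef

/-- The binary logarithm of a Hermitian matrix, by functional calculus; the eigenvalue `0` is sent
to `0`, which implements the convention `0 log 0 = 0`. -/
def matrixLog (ρ : Matrix n n ℂ) : Matrix n n ℂ := cfc (Real.logb 2) ρ

/-- The maximally mixed state `𝟙 / |n|`. -/
def maximallyMixed (n : Type) [Fintype n] [DecidableEq n] : Matrix n n ℂ :=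
  (Fintype.card n : ℂ)⁻¹ • (1 : Matrix n n ℂ)

open Classical in
/-- Quantum relative entropy `D(ρ‖σ) = Tr (ρ log ρ - ρ log σ)` in bits, equal to `+∞` when the
support of `ρ` is not contained in the support of `σ`. -/
def relEntropy (ρ σ : Matrix n n ℂ) : EReal :=
  if LinearMap.ker σ.toLin' ≤ LinearMap.ker ρ.toLin' then
    (((ρ * matrixLog ρ - ρ * matrixLog σ).trace.re : ℝ) : EReal)
  else ⊤

/-- Von Neumann entropy `S(ρ) = - Tr (ρ log ρ)` in bits. -/
def vonNeumannEntropy (ρ : Matrix n n ℂ) : ℝ := -(ρ * matrixLog ρ).trace.re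

/-- Global purity `G(ρ) = log |n| - S(ρ)`. -/
def globalPurity (ρ : Matrix n n ℂ) : ℝ :=
  Real.logb 2 (Fintype.card n) - vonNeumannEntropy ρ

/-- The trace norm `Tr |X| = Tr √(X† X)`, i.e. the sum of the singular values of `X`. -/
def traceNorm (X : Matrix n n ℂ) : ℝ :=
  ∑ i, Real.sqrt ((Matrix.isHermitian_conjTranspose_mul_self X).eigenvalues i)

end States

/-! ### CLODCC operations of three parties -/

/-- A finite-dimensional tripartite quantum system, given by orthonormal (computational) bases of
the Hilbert spaces held by the parties `A`, `C` and `B`. -/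
structure TripartiteSystem where
  A : Type
  C : Type
  B : Type
  [fintypeA : Fintype A]
  [fintypeC : Fintype C]
  [fintypeB : Fintype B]
  [decEqA : DecidableEq A]
  [decEqC : DecidableEq C]
  [decEqB : DecidableEq B]

attribute [instance] TripartiteSystem.fintypeA TripartiteSystem.fintypeC
  TripartiteSystem.fintypeB TripartiteSystem.decEqA TripartiteSystem.decEqC
  TripartiteSystem.decEqB

/-- Computational basis of the joint Hilbert space. -/
abbrev TripartiteSystem.Basis (S : TripartiteSystem) : Type := S.A × S.C × S.B

/-- Operators on the joint Hilbert space. -/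
abbrev TripartiteSystem.Op (S : TripartiteSystem) : Type := Matrix S.Basis S.Basis ℂ

/-- `U` is a unitary map from the space with basis `m` onto the space with basis `n`. (It may go
between differently presented spaces, such as `H` and a tensor factorisation of `H`.) -/
def IsUnitaryMap {m n : Type} [Fintype m] [Fintype n] [DecidableEq m] [DecidableEq n]
    (U : Matrix n m ℂ) : Prop :=
  U * U.conjTranspose = 1 ∧ U.conjTranspose * U = 1

/-- Dephasing of a register in the computational basis, together with handing the register over to
another party: `place` says which basis vector of the old arrangement `S` corresponds to a basis
vector of the new arrangement `T`, and `reg` reads off the register. Matrix elements between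
different register values are erased. -/
def dephaseAndMove {S T M : Type} [DecidableEq M] (reg : T → M) (place : T → S)
    (X : Matrix S S ℂ) : Matrix T T ℂ :=
  Matrix.of fun x y => if reg x = reg y then X (place x) (place y) else 0

/-- `CLODCC S T Λ`: the map `Λ`, from operators on the tripartite system `S` to operators on the
tripartite system `T`, is a closed local operation with communication through dephasing channels.
This is the class generated by local unitaries and by sending a subsystem `M` from one party to
another through the dephasing channel, under composition, infinite compositions (limits) included.
No ancilla may be added and nothing may be discarded. -/
inductive CLODCC : (S T : TripartiteSystem) → (S.Op → T.Op) → Prop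
  | localUnitaries {A C B A' C' B' : Type}
      [Fintype A] [Fintype C] [Fintype B] [Fintype A'] [Fintype C'] [Fintype B']
      [DecidableEq A] [DecidableEq C] [DecidableEq B]
      [DecidableEq A'] [DecidableEq C'] [DecidableEq B']
      (U : Matrix A' A ℂ) (V : Matrix C' C ℂ) (W : Matrix B' B ℂ)
      (hU : IsUnitaryMap U) (hV : IsUnitaryMap V) (hW : IsUnitaryMap W) :
      CLODCC ⟨A, C, B⟩ ⟨A', C', B'⟩
        (fun X => (U ⊗ₖ (V ⊗ₖ W)) * X * (U ⊗ₖ (V ⊗ₖ W)).conjTranspose)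
  | sendAC {A C B M : Type} [Fintype A] [Fintype C] [Fintype B] [Fintype M]
      [DecidableEq A] [DecidableEq C] [DecidableEq B] [DecidableEq M] :
      CLODCC ⟨A × M, C, B⟩ ⟨A, C × M, B⟩
        (dephaseAndMove (fun (_, (_, m), _) => m) (fun (a, (c, m), b) => ((a, m), c, b)))
  | sendCA {A C B M : Type} [Fintype A] [Fintype C] [Fintype B] [Fintype M]
      [DecidableEq A] [DecidableEq C] [DecidableEq B] [DecidableEq M] :
      CLODCC ⟨A, C × M, B⟩ ⟨A × M, C, B⟩
        (dephaseAndMove (fun ((_, m), _, _) => m) (fun ((a, m), c, b) => (a, (c, m), b)))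
  | sendBC {A C B M : Type} [Fintype A] [Fintype C] [Fintype B] [Fintype M]
      [DecidableEq A] [DecidableEq C] [DecidableEq B] [DecidableEq M] :
      CLODCC ⟨A, C, B × M⟩ ⟨A, C × M, B⟩
        (dephaseAndMove (fun (_, (_, m), _) => m) (fun (a, (c, m), b) => (a, c, (b, m))))
  | sendCB {A C B M : Type} [Fintype A] [Fintype C] [Fintype B] [Fintype M]
      [DecidableEq A] [DecidableEq C] [DecidableEq B] [DecidableEq M] :
      CLODCC ⟨A, C × M, B⟩ ⟨A, C, B × M⟩
        (dephaseAndMove (fun (_, _, (_, m)) => m) (fun (a, c, (b, m)) => (a, (c, m), b)))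
  | sendAB {A C B M : Type} [Fintype A] [Fintype C] [Fintype B] [Fintype M]
      [DecidableEq A] [DecidableEq C] [DecidableEq B] [DecidableEq M] :
      CLODCC ⟨A × M, C, B⟩ ⟨A, C, B × M⟩
        (dephaseAndMove (fun (_, _, (_, m)) => m) (fun (a, c, (b, m)) => ((a, m), c, b)))
  | sendBA {A C B M : Type} [Fintype A] [Fintype C] [Fintype B] [Fintype M]
      [DecidableEq A] [DecidableEq C] [DecidableEq B] [DecidableEq M] :
      CLODCC ⟨A, C, B × M⟩ ⟨A × M, C, B⟩
        (dephaseAndMove (fun ((_, m), _, _) => m) (fun ((a, m), c, b) => (a, c, (b, m))))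
  | comp {S T R : TripartiteSystem} {f : S.Op → T.Op} {g : T.Op → R.Op} :
      CLODCC S T f → CLODCC T R g → CLODCC S R (g ∘ f)
  | limit {S T : TripartiteSystem} {f : ℕ → S.Op → T.Op} {g : S.Op → T.Op} :
      (∀ k, CLODCC S T (f k)) → (∀ X, Tendsto (fun k => f k X) atTop (𝓝 (g X))) → CLODCC S T g

/-- The partial trace over the party `C`. -/
def traceC {A C B : Type} [Fintype C] (X : Matrix (A × C × B) (A × C × B) ℂ) :
    Matrix (A × B) (A × B) ℂ :=
  Matrix.of fun p q => ∑ c, X (p.1, c, p.2) (q.1, c, q.2)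

/-! ### Local idits and the repeated private randomness rate -/

/-- Local independent states with randomness at `A`: for a key register with basis `K` and a shield
`A'B'`, the states `τ (|+⟩⟨+|_K ⊗ σ_{A'B'}) τ†` with a twisting `τ = ∑ i, |i⟩⟨i|_K ⊗ U i`, that is
`∑ i j, (1 / |K|) |i⟩⟨j| ⊗ U i σ (U j)†`. Party `A` holds `K` and `A'`, party `B` holds `B'`. -/
def IsLocalIdit {K A' B' : Type} [Fintype K] [Fintype A'] [Fintype B']
    [DecidableEq A'] [DecidableEq B']
    (α : Matrix ((K × A') × B') ((K × A') × B') ℂ) : Prop :=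
  ∃ (σ : Matrix (A' × B') (A' × B') ℂ) (U : K → Matrix (A' × B') (A' × B') ℂ),
    IsState σ ∧ (∀ i, IsUnitaryMap (U i)) ∧
    α = Matrix.of fun p q =>
      (Fintype.card K : ℂ)⁻¹ *
        (U p.1.1 * σ * (U q.1.1).conjTranspose) (p.1.2, p.2) (q.1.2, q.2)

section Rate

variable {A C₁ C₂ B : Type} [Fintype A] [Fintype C₁] [Fintype C₂] [Fintype B]
  [DecidableEq A] [DecidableEq C₁] [DecidableEq C₂] [DecidableEq B]

/-- The system on which `n` copies of `ρ_{AC₁} ⊗ ρ'_{C₂B}` live; party `C` holds `(C₁C₂)ⁿ`. -/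
abbrev copiesSystem (A C₁ C₂ B : Type) [Fintype A] [Fintype C₁] [Fintype C₂] [Fintype B]
    [DecidableEq A] [DecidableEq C₁] [DecidableEq C₂] [DecidableEq B] (n : ℕ) :
    TripartiteSystem :=
  ⟨Fin n → A, Fin n → C₁ × C₂, Fin n → B⟩

/-- The state `(ρ_{AC₁} ⊗ ρ'_{C₂B})^{⊗ n}`. -/
def copies (ρ : Matrix (A × C₁) (A × C₁) ℂ) (ρ' : Matrix (C₂ × B) (C₂ × B) ℂ) (n : ℕ) :
    (copiesSystem A C₁ C₂ B n).Op :=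
  Matrix.of fun x y => ∏ k : Fin n,
    ρ (x.1 k, (x.2.1 k).1) (y.1 k, (y.2.1 k).1) * ρ' ((x.2.1 k).2, x.2.2 k) ((y.2.1 k).2, y.2.2 k)

/-- `n` copies of `ρ_{AC₁} ⊗ ρ'_{C₂B}` can be transformed by CLODCC operations of the three
parties, followed by discarding `C`, into a state which is `ε`-close in trace norm to a local idit
at `A` with key dimension `d`, i.e. containing `log₂ d` bits of private randomness. -/
def CanDistill (ρ : Matrix (A × C₁) (A × C₁) ℂ) (ρ' : Matrix (C₂ × B) (C₂ × B) ℂ)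
    (ε : ℝ) (n d : ℕ) : Prop :=
  ∃ (a c b : ℕ)
    (Λ : (copiesSystem A C₁ C₂ B n).Op →
      (⟨Fin d × Fin a, Fin c, Fin b⟩ : TripartiteSystem).Op)
    (α : Matrix ((Fin d × Fin a) × Fin b) ((Fin d × Fin a) × Fin b) ℂ),
    CLODCC (copiesSystem A C₁ C₂ B n) ⟨Fin d × Fin a, Fin c, Fin b⟩ Λ ∧
    IsLocalIdit α ∧
    traceNorm (traceC (Λ (copies ρ ρ' n)) - α) ≤ ε

/-- The repeated private randomness rate localised at `A`:
`inf_{ε > 0} limsup_{n → ∞} sup {m / n : Tr_C Λ((ρ ⊗ ρ')^{⊗ n}) ≈_ε α_m}`,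
where `m = log₂ d` is the number of random bits of the idit. -/
def repeatedRandomnessRate (ρ : Matrix (A × C₁) (A × C₁) ℂ)
    (ρ' : Matrix (C₂ × B) (C₂ × B) ℂ) : EReal :=
  ⨅ (ε : ℝ) (_ : 0 < ε), limsup (fun n : ℕ =>
    ⨆ (d : ℕ) (_ : CanDistill ρ ρ' ε n d), ((Real.logb 2 d / n : ℝ) : EReal)) atTop

end Rate

end PrivateRandomness

end

/-! The proof works in the Heisenberg picture. Distilling an idit is turned into a hypothesis test
between the partially transposed input and the maximally mixed state.

Each CLODCC map pulls an observable `R` back to some `Q` of equal trace. If the partial transpose of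
`R` over `C` is an effect, so is that of `Q` (`CLODCC.hasPPTDual`): a local unitary on `C` becomes
its complex conjugate, and a dephased register is diagonal, so moving it into or out of `C` commutes
with transposition.

An idit with key dimension `d` lives on a projection `P` whose rank is the shield dimension, a
fraction `1/d` of the space. `P ⊗ 1_C` is invariant under transposition of `C`, so its pull-back,
partially transposed, is an effect. It accepts the partially transposed input with probability at
least `1 - ε` and the maximally mixed state with probability at most `1/d`. For PPT inputs the
former is a genuine state, and `hypothesisTest_le` gives `(1 - ε) log d ≤ n G + 1`, where `G` is the
sum of the two global purities. Dividing by `n`, letting `n → ∞` and then `ε → 0` proves the bound.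
-/

namespace PrivateRandomness

/-! ### Effects -/

/-- Effects `0 ≤ Q ≤ 1`. -/
def IsEffect {n : Type} [DecidableEq n] (Q : Matrix n n ℂ) : Prop :=
  Q.PosSemidef ∧ (1 - Q).PosSemidef

section Effects

variable {m n : Type} [DecidableEq m] [DecidableEq n]

lemma IsEffect.one : IsEffect (1 : Matrix n n ℂ) := by
  refine ⟨Matrix.PosSemidef.one, ?_⟩
  rw [sub_self]
  exact Matrix.PosSemidef.zero

lemma IsEffect.submatrix {P : Matrix n n ℂ} (hP : IsEffect P) (e : m ≃ n) :
    IsEffect (P.submatrix e e) := by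
  refine ⟨hP.1.submatrix e, ?_⟩
  have h := hP.2.submatrix e
  rwa [Matrix.submatrix_sub, Pi.sub_apply, Pi.sub_apply, Matrix.submatrix_one_equiv] at h

variable [Fintype m] [Fintype n]

lemma IsEffect.conj {P : Matrix n n ℂ} (hP : IsEffect P) {K : Matrix n m ℂ}
    (hK : K.conjTranspose * K = 1) : IsEffect (K.conjTranspose * P * K) := by
  refine ⟨hP.1.conjTranspose_mul_mul_same K, ?_⟩
  have h := hP.2.conjTranspose_mul_mul_same K
  rwa [Matrix.mul_sub, Matrix.sub_mul, Matrix.mul_one, hK] at h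

/-- Erasing the matrix elements between different register values. -/
def dephase {n M : Type} [DecidableEq M] (reg : n → M) (X : Matrix n n ℂ) : Matrix n n ℂ :=
  Matrix.of fun x y => if reg x = reg y then X x y else 0

/-- Dephasing is the Schur product with the Gram matrix of the register indicators, so the Schur
product theorem applies. -/
lemma posSemidef_dephase {n M : Type} [Fintype n] [Fintype M] [DecidableEq M]
    (reg : n → M) {P : Matrix n n ℂ} (hP : P.PosSemidef) : (dephase reg P).PosSemidef := by
  let B : Matrix M n ℂ := Matrix.of fun m x => if m = reg x then 1 else 0
  have h : ((B.conjTranspose * B).hadamard P).PosSemidef :=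
    (Matrix.posSemidef_conjTranspose_mul_self B).hadamard hP
  have e : dephase reg P = (B.conjTranspose * B).hadamard P := by
    ext x y
    simp [B, dephase, Matrix.mul_apply, eq_comm (a := reg x)]
  rwa [e]

lemma IsEffect.dephase {M : Type} [Fintype M] [DecidableEq M] (reg : n → M)
    {P : Matrix n n ℂ} (hP : IsEffect P) : IsEffect (dephase reg P) := by
  refine ⟨posSemidef_dephase reg hP.1, ?_⟩
  -- Dephasing fixes the identity, hence commutes with taking complements.
  convert posSemidef_dephase reg hP.2 using 1
  ext x y
  by_cases h : x = y
  · simp [PrivateRandomness.dephase, h]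
  · by_cases h' : reg x = reg y <;> simp [PrivateRandomness.dephase, h, h']

lemma posSemidef_of_tendsto {n : Type} [Fintype n] {f : ℕ → Matrix n n ℂ} {Q : Matrix n n ℂ}
    (hf : ∀ k, (f k).PosSemidef) (h : Tendsto f atTop (𝓝 Q)) : Q.PosSemidef := by
  rw [Matrix.posSemidef_iff_dotProduct_mulVec]
  constructor
  · have h1 : Tendsto (fun k => (f k).conjTranspose) atTop (𝓝 Q.conjTranspose) :=
      ((continuous_id.matrix_conjTranspose).tendsto Q).comp h
    have h2 : (fun k => (f k).conjTranspose) = f := funext fun k => (hf k).1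
    rw [h2] at h1
    exact tendsto_nhds_unique h1 h
  · intro x
    have hc : Continuous fun A : Matrix n n ℂ => star x ⬝ᵥ A.mulVec x := by fun_prop
    exact ge_of_tendsto ((hc.tendsto Q).comp h)
      (Eventually.of_forall fun k => (hf k).dotProduct_mulVec_nonneg x)

lemma isEffect_of_tendsto {f : ℕ → Matrix n n ℂ} {Q : Matrix n n ℂ}
    (hf : ∀ k, IsEffect (f k)) (h : Tendsto f atTop (𝓝 Q)) : IsEffect Q :=
  ⟨posSemidef_of_tendsto (fun k => (hf k).1) h,
    posSemidef_of_tendsto (fun k => (hf k).2) (h.const_sub 1)⟩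

end Effects

/-! ### Partial transposition of party `C` and dual maps -/

section Dual

/-- The partial transposition of party `C`. -/
def transposeC {A C B : Type} (X : Matrix (A × C × B) (A × C × B) ℂ) :
    Matrix (A × C × B) (A × C × B) ℂ :=
  Matrix.of fun x y => X (x.1, y.2.1, x.2.2) (y.1, x.2.1, y.2.2)

/-- Exchange of the `C` components of a pair of basis vectors. -/
def swapC (A C B : Type) : (A × C × B) × (A × C × B) ≃ (A × C × B) × (A × C × B) where
  toFun p := ((p.1.1, p.2.2.1, p.1.2.2), (p.2.1, p.1.2.1, p.2.2.2))
  invFun p := ((p.1.1, p.2.2.1, p.1.2.2), (p.2.1, p.1.2.1, p.2.2.2))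
  left_inv _ := rfl
  right_inv _ := rfl

lemma continuous_transposeC {A C B : Type} :
    Continuous (transposeC : Matrix (A × C × B) (A × C × B) ℂ → _) :=
  continuous_pi fun _ => continuous_pi fun _ => continuous_apply_apply _ _

variable {A C B : Type}

lemma transposeC_one [DecidableEq A] [DecidableEq C] [DecidableEq B] :
    transposeC (1 : Matrix (A × C × B) (A × C × B) ℂ) = 1 := by
  ext ⟨a, c, b⟩ ⟨a', c', b'⟩
  simp only [transposeC, Matrix.of_apply, Matrix.one_apply, Prod.mk.injEq, eq_comm (a := c')]

/-- Transposing `C` exchanges the two copies of `V` acting on that factor, which amounts to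
conjugating its entries. In the expanded double sum this is the reindexing by `swapC`. -/
lemma transposeC_conj {A' C' B' : Type} [Fintype A'] [Fintype C'] [Fintype B']
    (U : Matrix A' A ℂ) (V : Matrix C' C ℂ) (W : Matrix B' B ℂ)
    (R : Matrix (A' × C' × B') (A' × C' × B') ℂ) :
    transposeC ((U ⊗ₖ (V ⊗ₖ W)).conjTranspose * R * (U ⊗ₖ (V ⊗ₖ W))) =
      (U ⊗ₖ (V.map star ⊗ₖ W)).conjTranspose * transposeC R * (U ⊗ₖ (V.map star ⊗ₖ W)) := by
  have key : ∀ (K : Matrix (A' × C' × B') (A × C × B) ℂ) (P : Matrix (A' × C' × B') (A' × C' × B') ℂ)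
      (x y), (K.conjTranspose * P * K) x y =
        ∑ p : (A' × C' × B') × (A' × C' × B'), star (K p.1 x) * P p.1 p.2 * K p.2 y := by
    intro K P x y
    rw [Fintype.sum_prod_type, Finset.sum_comm]
    simp [Matrix.mul_apply, Finset.sum_mul]
  ext x y
  rw [transposeC, Matrix.of_apply, key, key]
  refine Fintype.sum_equiv (swapC A' C' B') _ _ fun p => ?_
  simp only [swapC, Equiv.coe_fn_mk, transposeC, Matrix.of_apply, Matrix.kroneckerMap_apply,
    Matrix.map_apply, star_mul', star_star]
  ring

variable [Fintype A] [Fintype C] [Fintype B]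

lemma trace_mul_eq_sum {n : Type} [Fintype n] (X Y : Matrix n n ℂ) :
    (X * Y).trace = ∑ p : n × n, X p.1 p.2 * Y p.2 p.1 := by
  simp [Matrix.trace, Matrix.mul_apply, Fintype.sum_prod_type]

/-- Both traces are one sum over pairs of basis vectors, reindexed by `swapC`. Thus test and state
may be partially transposed together without changing the acceptance probability. -/
lemma trace_transposeC_mul_transposeC (X Y : Matrix (A × C × B) (A × C × B) ℂ) :
    (transposeC X * transposeC Y).trace = (X * Y).trace := by
  rw [trace_mul_eq_sum, trace_mul_eq_sum]
  exact Fintype.sum_equiv (swapC A C B) _ _ fun _ => rfl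

lemma trace_transposeC (X : Matrix (A × C × B) (A × C × B) ℂ) :
    (transposeC X).trace = X.trace := rfl

/-- Every observable pulls back along `f` with the same trace, and the partial transpose over `C`
of the pull-back is an effect as soon as that of the observable is. -/
def HasPPTDual (S T : TripartiteSystem) (f : S.Op → T.Op) : Prop :=
  ∀ R : T.Op, ∃ Q : S.Op, (∀ X, (R * f X).trace = (Q * X).trace) ∧ Q.trace = R.trace ∧
    (IsEffect (transposeC R) → IsEffect (transposeC Q))

lemma HasPPTDual.comp {S T R : TripartiteSystem} {f : S.Op → T.Op} {g : T.Op → R.Op}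
    (hf : HasPPTDual S T f) (hg : HasPPTDual T R g) : HasPPTDual S R (g ∘ f) := by
  intro P
  obtain ⟨Q, h1, h2, h3⟩ := hg P
  obtain ⟨Q', h1', h2', h3'⟩ := hf Q
  exact ⟨Q', fun X => (h1 (f X)).trans (h1' X), h2'.trans h2, h3' ∘ h3⟩

lemma HasPPTDual.limit {S T : TripartiteSystem} {f : ℕ → S.Op → T.Op} {g : S.Op → T.Op}
    (hf : ∀ k, HasPPTDual S T (f k)) (hg : ∀ X, Tendsto (fun k => f k X) atTop (𝓝 (g X))) :
    HasPPTDual S T g := by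
  intro R
  choose Q h1 h2 h3 using fun k => hf k R
  have hR : ∀ X, Tendsto (fun k => (Q k * X).trace) atTop (𝓝 (R * g X).trace) := by
    intro X
    have hc : Continuous fun Y : T.Op => (R * Y).trace := by fun_prop
    have h := (hc.tendsto (g X)).comp (hg X)
    exact h.congr fun k => h1 k X
  -- The entry `Q x y` is the trace of `Q` against the matrix unit at `(y, x)`, so the duals
  -- converge entrywise. The trace identity for arbitrary `X` then follows from uniqueness of
  -- limits, without using linearity of `g`.
  let Q' : S.Op := Matrix.of fun x y => (R * g (Matrix.single y x 1)).trace
  have hQ : Tendsto Q atTop (𝓝 Q') := by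
    refine tendsto_pi_nhds.2 fun x => tendsto_pi_nhds.2 fun y => ?_
    refine (hR (Matrix.single y x 1)).congr fun k => ?_
    rw [Matrix.trace_mul_single]
    simp
  refine ⟨Q', fun X => ?_, ?_, fun hE => ?_⟩
  · have hc : Continuous fun Y : S.Op => (Y * X).trace := by fun_prop
    exact tendsto_nhds_unique (hR X) ((hc.tendsto Q').comp hQ)
  · have hc : Continuous fun Y : S.Op => Y.trace := by fun_prop
    have h := (hc.tendsto Q').comp hQ
    exact tendsto_nhds_unique h (tendsto_const_nhds.congr fun k => (h2 k).symm)
  · exact isEffect_of_tendsto (fun k => h3 k hE) ((continuous_transposeC.tendsto Q').comp hQ)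

lemma isUnitaryMap_kronecker {m n m' n' : Type} [Fintype m] [Fintype n] [Fintype m'] [Fintype n']
    [DecidableEq m] [DecidableEq n] [DecidableEq m'] [DecidableEq n']
    {U : Matrix n m ℂ} {V : Matrix n' m' ℂ} (hU : IsUnitaryMap U) (hV : IsUnitaryMap V) :
    IsUnitaryMap (U ⊗ₖ V) := by
  constructor
  · rw [Matrix.conjTranspose_kronecker, ← Matrix.mul_kronecker_mul, hU.1, hV.1,
      Matrix.one_kronecker_one]
  · rw [Matrix.conjTranspose_kronecker, ← Matrix.mul_kronecker_mul, hU.2, hV.2,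
      Matrix.one_kronecker_one]

lemma isUnitaryMap_map_star {m n : Type} [Fintype m] [Fintype n] [DecidableEq m] [DecidableEq n]
    {U : Matrix n m ℂ} (hU : IsUnitaryMap U) : IsUnitaryMap (U.map star) := by
  have h1 := congrArg Matrix.transpose hU.1
  have h2 := congrArg Matrix.transpose hU.2
  rw [Matrix.transpose_mul, Matrix.transpose_one] at h1 h2
  constructor
  · rw [← h1]; ext i j; simp [Matrix.mul_apply, mul_comm]
  · rw [← h2]; ext i j; simp [Matrix.mul_apply]

lemma hasPPTDual_localUnitaries {A' C' B' : Type} [Fintype A'] [Fintype C'] [Fintype B']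
    [DecidableEq A] [DecidableEq C] [DecidableEq B]
    [DecidableEq A'] [DecidableEq C'] [DecidableEq B']
    {U : Matrix A' A ℂ} {V : Matrix C' C ℂ} {W : Matrix B' B ℂ}
    (hU : IsUnitaryMap U) (hV : IsUnitaryMap V) (hW : IsUnitaryMap W) :
    HasPPTDual ⟨A, C, B⟩ ⟨A', C', B'⟩
      (fun X => (U ⊗ₖ (V ⊗ₖ W)) * X * (U ⊗ₖ (V ⊗ₖ W)).conjTranspose) := by
  intro R
  refine ⟨(U ⊗ₖ (V ⊗ₖ W)).conjTranspose * R * (U ⊗ₖ (V ⊗ₖ W)), fun X => ?_, ?_, fun hE => ?_⟩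
  · rw [← Matrix.mul_assoc, Matrix.trace_mul_comm, ← Matrix.mul_assoc, ← Matrix.mul_assoc]
  · rw [Matrix.trace_mul_comm, ← Matrix.mul_assoc,
      (isUnitaryMap_kronecker hU (isUnitaryMap_kronecker hV hW)).1, Matrix.one_mul]
  · rw [transposeC_conj]
    exact hE.conj (isUnitaryMap_kronecker hU (isUnitaryMap_kronecker (isUnitaryMap_map_star hV) hW)).2

/-- The dual dephases the observable and hands the register back. Diagonal entries are untouched, so
the trace is kept; `h` is the only point that depends on who holds the register. -/
lemma hasPPTDual_dephaseAndMove {S T : TripartiteSystem} {M : Type} [Fintype M] [DecidableEq M]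
    (reg : T.Basis → M) (e : T.Basis ≃ S.Basis)
    (h : ∀ R : T.Op, transposeC ((dephase reg R).submatrix e.symm e.symm) =
      (dephase reg (transposeC R)).submatrix e.symm e.symm) :
    HasPPTDual S T (dephaseAndMove reg e) := by
  intro R
  refine ⟨(dephase reg R).submatrix e.symm e.symm, fun X => ?_, ?_, fun hE => ?_⟩
  · rw [trace_mul_eq_sum, trace_mul_eq_sum]
    refine Fintype.sum_equiv (e.prodCongr e) _ _ fun p => ?_
    by_cases hp : reg p.1 = reg p.2
    · simp [dephaseAndMove, dephase, hp]
    · simp [dephaseAndMove, dephase, hp, Ne.symm hp]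
  · refine Fintype.sum_equiv e.symm _ _ fun x => ?_
    simp [dephase]
  · rw [h]
    exact (hE.dephase reg).submatrix e.symm

lemma CLODCC.hasPPTDual {S T : TripartiteSystem} {f : S.Op → T.Op} (hf : CLODCC S T f) :
    HasPPTDual S T f := by
  induction hf with
  | localUnitaries U V W hU hV hW => exact hasPPTDual_localUnitaries hU hV hW
  | @sendAC A C B M =>
    refine hasPPTDual_dephaseAndMove (S := ⟨A × M, C, B⟩) (T := ⟨A, C × M, B⟩) _
      ⟨fun (a, (c, m), b) => ((a, m), c, b), fun ((a, m), c, b) => (a, (c, m), b),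
        fun _ => rfl, fun _ => rfl⟩ fun R => ?_
    ext ⟨⟨a, m⟩, c, b⟩ ⟨⟨a', m'⟩, c', b'⟩
    -- The register belongs to `C` on one side only. Where its values agree, transposing it does
    -- nothing; elsewhere both sides vanish.
    by_cases h : m = m'
    · subst h; simp [transposeC, dephase]
    · simp [transposeC, dephase, h]
  | @sendCA A C B M =>
    refine hasPPTDual_dephaseAndMove (S := ⟨A, C × M, B⟩) (T := ⟨A × M, C, B⟩) _
      ⟨fun ((a, m), c, b) => (a, (c, m), b), fun (a, (c, m), b) => ((a, m), c, b),
        fun _ => rfl, fun _ => rfl⟩ fun R => ?_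
    ext ⟨a, ⟨c, m⟩, b⟩ ⟨a', ⟨c', m'⟩, b'⟩
    by_cases h : m = m'
    · subst h; simp [transposeC, dephase]
    · simp [transposeC, dephase, h, Ne.symm h]
  | @sendBC A C B M =>
    refine hasPPTDual_dephaseAndMove (S := ⟨A, C, B × M⟩) (T := ⟨A, C × M, B⟩) _
      ⟨fun (a, (c, m), b) => (a, c, (b, m)), fun (a, c, (b, m)) => (a, (c, m), b),
        fun _ => rfl, fun _ => rfl⟩ fun R => ?_
    ext ⟨a, c, ⟨b, m⟩⟩ ⟨a', c', ⟨b', m'⟩⟩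
    by_cases h : m = m'
    · subst h; simp [transposeC, dephase]
    · simp [transposeC, dephase, h]
  | @sendCB A C B M =>
    refine hasPPTDual_dephaseAndMove (S := ⟨A, C × M, B⟩) (T := ⟨A, C, B × M⟩) _
      ⟨fun (a, c, (b, m)) => (a, (c, m), b), fun (a, (c, m), b) => (a, c, (b, m)),
        fun _ => rfl, fun _ => rfl⟩ fun R => ?_
    ext ⟨a, ⟨c, m⟩, b⟩ ⟨a', ⟨c', m'⟩, b'⟩
    by_cases h : m = m'
    · subst h; simp [transposeC, dephase]
    · simp [transposeC, dephase, h, Ne.symm h]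
  | @sendAB A C B M =>
    refine hasPPTDual_dephaseAndMove (S := ⟨A × M, C, B⟩) (T := ⟨A, C, B × M⟩) _
      ⟨fun (a, c, (b, m)) => ((a, m), c, b), fun ((a, m), c, b) => (a, c, (b, m)),
        fun _ => rfl, fun _ => rfl⟩ fun R => ?_
    ext ⟨⟨a, m⟩, c, b⟩ ⟨⟨a', m'⟩, c', b'⟩
    -- The register never enters `C`, so its dephasing commutes with the transposition of `C`.
    simp [transposeC, dephase]
  | @sendBA A C B M =>
    refine hasPPTDual_dephaseAndMove (S := ⟨A, C, B × M⟩) (T := ⟨A × M, C, B⟩) _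
      ⟨fun ((a, m), c, b) => (a, c, (b, m)), fun (a, c, (b, m)) => ((a, m), c, b),
        fun _ => rfl, fun _ => rfl⟩ fun R => ?_
    ext ⟨a, c, ⟨b, m⟩⟩ ⟨a', c', ⟨b', m'⟩⟩
    simp [transposeC, dephase]
  | comp _ _ hf hg => exact hf.comp hg
  | limit _ h hf => exact HasPPTDual.limit hf h

end Dual

/-! ### The trace norm and local idits -/

section TraceNorm

variable {n : Type} [Fintype n]

lemma star_dotProduct_self (v : n → ℂ) : (star v ⬝ᵥ v) = ((∑ i, ‖v i‖ ^ 2 : ℝ) : ℂ) := by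
  simp only [dotProduct, Pi.star_apply, Complex.ofReal_sum, Complex.ofReal_pow]
  exact Finset.sum_congr rfl fun i _ => Complex.conj_mul' (v i)

lemma norm_star_dotProduct_le (v w : n → ℂ) :
    ‖star v ⬝ᵥ w‖ ≤ √(∑ i, ‖v i‖ ^ 2) * √(∑ i, ‖w i‖ ^ 2) := by
  refine (norm_sum_le _ _).trans ?_
  simp only [norm_mul, Pi.star_apply, norm_star]
  exact Real.sum_mul_le_sqrt_mul_sqrt _ _ _

variable [DecidableEq n]

/-- A projection tested on `X` is bounded by the trace norm of `X`. -/
lemma norm_trace_mul_le_traceNorm {P : Matrix n n ℂ} (hP : P.conjTranspose = P) (hPP : P * P = P)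
    (X : Matrix n n ℂ) : ‖(P * X).trace‖ ≤ traceNorm X := by
  have hH := Matrix.isHermitian_conjTranspose_mul_self X
  set V : Matrix n n ℂ := (hH.eigenvectorUnitary : Matrix n n ℂ) with hV
  have hV1 : V * V.conjTranspose = 1 := Unitary.coe_mul_star_self hH.eigenvectorUnitary
  have hV2 : V.conjTranspose * V = 1 := Unitary.coe_star_mul_self hH.eigenvectorUnitary
  have hdiag : V.conjTranspose * (X.conjTranspose * X) * V =
      Matrix.diagonal fun i => ((hH.eigenvalues i : ℝ) : ℂ) := by
    have h := hH.conjStarAlgAut_star_eigenvectorUnitary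
    rw [Unitary.conjStarAlgAut_star_apply] at h
    exact h
  -- The trace is taken in an eigenbasis of `X† X`. There the columns of `X V` have the singular
  -- values as norms and those of `P V` have norm at most one, so Cauchy–Schwarz bounds each
  -- diagonal entry.
  have htr : (P * X).trace = ∑ i, (V.conjTranspose * P * (X * V)) i i := by
    change _ = (V.conjTranspose * P * (X * V)).trace
    rw [← Matrix.mul_assoc, Matrix.trace_mul_comm (_ * X) V, ← Matrix.mul_assoc,
      ← Matrix.mul_assoc, hV1, Matrix.one_mul]
  rw [htr, traceNorm]
  refine (norm_sum_le _ _).trans (Finset.sum_le_sum fun i _ => ?_)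
  have hentry : (V.conjTranspose * P * (X * V)) i i =
      star (fun j => (P * V) j i) ⬝ᵥ fun j => (X * V) j i := by
    have : V.conjTranspose * P = (P * V).conjTranspose := by
      rw [Matrix.conjTranspose_mul, hP]
    rw [this, Matrix.mul_apply]
    rfl
  have hX : (∑ j, ‖(X * V) j i‖ ^ 2) = hH.eigenvalues i := by
    have h := congrFun (congrFun hdiag i) i
    have h2 : V.conjTranspose * (X.conjTranspose * X) * V = (X * V).conjTranspose * (X * V) := by
      simp only [Matrix.conjTranspose_mul, Matrix.mul_assoc]
    rw [h2, Matrix.diagonal_apply_eq, Matrix.mul_apply] at h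
    have h3 := star_dotProduct_self fun j => (X * V) j i
    exact_mod_cast h3.symm.trans h
  have hPV : (∑ j, ‖(P * V) j i‖ ^ 2) ≤ 1 := by
    -- Pythagoras: a unit column of `V` splits into its components in the ranges of `P` and `1 - P`.
    have hsum : ((P * V).conjTranspose * (P * V)) i i +
        (((1 - P) * V).conjTranspose * ((1 - P) * V)) i i = 1 := by
      rw [← Matrix.add_apply]
      have : (P * V).conjTranspose * (P * V) + ((1 - P) * V).conjTranspose * ((1 - P) * V) = 1 := by
        have e : (1 - P) * (1 - P) = 1 - P := IsIdempotentElem.one_sub hPP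
        calc _ = V.conjTranspose * (P * P) * V + V.conjTranspose * ((1 - P) * (1 - P)) * V := by
              rw [Matrix.conjTranspose_mul, Matrix.conjTranspose_mul, Matrix.conjTranspose_sub,
                Matrix.conjTranspose_one, hP]
              simp only [Matrix.mul_assoc]
          _ = 1 := by
              rw [hPP, e, ← Matrix.add_mul, ← Matrix.mul_add, add_sub_cancel, Matrix.mul_one, hV2]
      rw [this, Matrix.one_apply_eq]
    have h1 := star_dotProduct_self fun j => (P * V) j i
    have h2 := star_dotProduct_self fun j => ((1 - P) * V) j i
    have h3 : ((∑ j, ‖(P * V) j i‖ ^ 2 : ℝ) : ℂ) + ((∑ j, ‖((1 - P) * V) j i‖ ^ 2 : ℝ) : ℂ) = 1 := by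
      rw [← h1, ← h2]
      exact hsum
    have h4 : (∑ j, ‖(P * V) j i‖ ^ 2) + (∑ j, ‖((1 - P) * V) j i‖ ^ 2) = 1 := by exact_mod_cast h3
    have h5 : 0 ≤ ∑ j, ‖((1 - P) * V) j i‖ ^ 2 := Finset.sum_nonneg fun _ _ => by positivity
    linarith
  rw [hentry]
  refine (norm_star_dotProduct_le _ _).trans ?_
  rw [hX]
  exact mul_le_of_le_one_left (Real.sqrt_nonneg _) (Real.sqrt_le_one.2 hPV)

end TraceNorm

/-- A local idit is supported on a projection whose rank is the dimension of the shield. -/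
lemma IsLocalIdit.exists_projection {K A' B' : Type} [Fintype K] [Fintype A'] [Fintype B']
    [DecidableEq A'] [DecidableEq B'] [Nonempty K]
    {α : Matrix ((K × A') × B') ((K × A') × B') ℂ} (hα : IsLocalIdit α) :
    ∃ P : Matrix ((K × A') × B') ((K × A') × B') ℂ, P.conjTranspose = P ∧ P * P = P ∧
      P.trace = (Fintype.card (A' × B') : ℂ) ∧ (P * α).trace = 1 := by
  obtain ⟨σ, U, hσ, hU, rfl⟩ := hα
  have hK : (Fintype.card K : ℝ) ≠ 0 := by exact_mod_cast Fintype.card_ne_zero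
  set r : ℝ := (√(Fintype.card K : ℝ))⁻¹ with hr
  have hrr : (r : ℂ) * r = (Fintype.card K : ℂ)⁻¹ := by
    rw [← Complex.ofReal_mul, hr, ← mul_inv, Real.mul_self_sqrt (Nat.cast_nonneg _)]
    push_cast; rfl
  -- `T` sends a shield vector `s` to the twisted vector `|K|^(-1/2) ∑ k, |k⟩ ⊗ U k s`. It is an
  -- isometry with `α = T σ T†`, so its range projection `T T†` is the one sought.
  let T : Matrix ((K × A') × B') (A' × B') ℂ := Matrix.of fun p s => r * U p.1.1 (p.1.2, p.2) s
  have hT : T.conjTranspose * T = 1 := by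
    ext s t
    have h : ∀ k, ∑ a, ∑ b, star (U k (a, b) s) * U k (a, b) t = (1 : Matrix _ _ ℂ) s t := by
      intro k
      rw [← (hU k).2, Matrix.mul_apply, Fintype.sum_prod_type]
      rfl
    have hterm : ∀ k a b, star ((r : ℂ) * U k (a, b) s) * (r * U k (a, b) t) =
        (Fintype.card K : ℂ)⁻¹ * (star (U k (a, b) s) * U k (a, b) t) := by
      intro k a b
      rw [← hrr, star_mul', Complex.star_def, Complex.conj_ofReal]
      ring
    rw [Matrix.mul_apply, Fintype.sum_prod_type, Fintype.sum_prod_type]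
    simp only [T, Matrix.conjTranspose_apply, Matrix.of_apply, hterm, ← Finset.mul_sum, h]
    rw [Finset.sum_const, Finset.card_univ, nsmul_eq_mul, ← mul_assoc,
      inv_mul_cancel₀ (by exact_mod_cast hK), one_mul]
  have hα : (Matrix.of fun p q : (K × A') × B' => (Fintype.card K : ℂ)⁻¹ *
        (U p.1.1 * σ * (U q.1.1).conjTranspose) (p.1.2, p.2) (q.1.2, q.2)) =
      T * σ * T.conjTranspose := by
    ext p q
    simp only [Matrix.of_apply, Matrix.mul_apply, T, Matrix.conjTranspose_apply, Finset.mul_sum,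
      Finset.sum_mul]
    refine Finset.sum_congr rfl fun x _ => Finset.sum_congr rfl fun y _ => ?_
    rw [← hrr, star_mul', Complex.star_def, Complex.conj_ofReal]
    ring
  refine ⟨T * T.conjTranspose, ?_, ?_, ?_, ?_⟩
  · rw [Matrix.conjTranspose_mul, Matrix.conjTranspose_conjTranspose]
  · rw [Matrix.mul_assoc, ← Matrix.mul_assoc _ T, hT, Matrix.one_mul]
  · rw [Matrix.trace_mul_comm, hT, Matrix.trace_one]
  · rw [hα, Matrix.mul_assoc, Matrix.mul_assoc T σ, ← Matrix.mul_assoc _ T, hT, Matrix.one_mul,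
      Matrix.trace_mul_comm, Matrix.mul_assoc, hT, Matrix.mul_one, hσ.2]

lemma isEffect_of_projection {n : Type} [Fintype n] [DecidableEq n] {P : Matrix n n ℂ}
    (hP : P.conjTranspose = P) (hPP : P * P = P) : IsEffect P := by
  constructor
  · have h := Matrix.posSemidef_conjTranspose_mul_self P
    rwa [hP, hPP] at h
  · have h := Matrix.posSemidef_conjTranspose_mul_self (1 - P)
    rw [Matrix.conjTranspose_sub, Matrix.conjTranspose_one, hP] at h
    have e : (1 - P) * (1 - P) = 1 - P := IsIdempotentElem.one_sub hPP
    rwa [e] at h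

/-! ### Extending observables on `AB` to `ACB` -/

section Extend

variable {A C B : Type} [DecidableEq C]

/-- The observable `P_{AB} ⊗ 1_C`. -/
def extendC (C : Type) [DecidableEq C] (P : Matrix (A × B) (A × B) ℂ) :
    Matrix (A × C × B) (A × C × B) ℂ :=
  (P ⊗ₖ (1 : Matrix C C ℂ)).submatrix (fun x => ((x.1, x.2.2), x.2.1)) fun x =>
    ((x.1, x.2.2), x.2.1)

/-- The identity on `C` is symmetric. This lets the observable for a discarded `C` enter the dual
argument as an effect. -/
lemma transposeC_extendC (P : Matrix (A × B) (A × B) ℂ) :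
    transposeC (extendC C P) = extendC C P := by
  ext ⟨a, c, b⟩ ⟨a', c', b'⟩
  simp [transposeC, extendC, Matrix.one_apply, eq_comm (a := c)]

variable [Fintype A] [Fintype C] [Fintype B]

lemma isEffect_extendC [DecidableEq A] [DecidableEq B] {P : Matrix (A × B) (A × B) ℂ} (hP : P.conjTranspose = P)
    (hPP : P * P = P) : IsEffect (extendC C P) := by
  let e : A × C × B ≃ (A × B) × C := ⟨fun x => ((x.1, x.2.2), x.2.1), fun x => (x.1.1, x.2, x.1.2),
    fun _ => rfl, fun _ => rfl⟩
  refine (isEffect_of_projection (P := P ⊗ₖ (1 : Matrix C C ℂ)) ?_ ?_).submatrix e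
  · rw [Matrix.conjTranspose_kronecker, hP, Matrix.conjTranspose_one]
  · rw [← Matrix.mul_kronecker_mul, hPP, Matrix.one_mul]

lemma trace_extendC (P : Matrix (A × B) (A × B) ℂ) :
    (extendC C P).trace = Fintype.card C * P.trace := by
  simp only [Matrix.trace, Matrix.diag_apply, extendC, Matrix.submatrix_apply,
    Matrix.kroneckerMap_apply, Matrix.one_apply_eq, mul_one, Fintype.sum_prod_type,
    Finset.sum_const, Finset.card_univ, nsmul_eq_mul, Finset.mul_sum]

lemma trace_extendC_mul (P : Matrix (A × B) (A × B) ℂ) (X : Matrix (A × C × B) (A × C × B) ℂ) :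
    (extendC C P * X).trace = (P * traceC X).trace := by
  simp only [Matrix.trace, Matrix.diag_apply, Matrix.mul_apply, extendC, Matrix.submatrix_apply,
    Matrix.kroneckerMap_apply, Matrix.one_apply, mul_ite, mul_one, mul_zero, ite_mul, zero_mul,
    Fintype.sum_prod_type, traceC, Matrix.of_apply, Finset.mul_sum, Finset.sum_ite_eq,
    Finset.sum_ite_irrel, Finset.sum_const_zero, Finset.mem_univ, if_true]
  refine Finset.sum_congr rfl fun a _ => ?_
  rw [Finset.sum_comm]
  refine Finset.sum_congr rfl fun b _ => ?_
  rw [Finset.sum_comm]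
  refine Finset.sum_congr rfl fun a' _ => ?_
  rw [Finset.sum_comm]

end Extend

/-! ### Spectral decompositions -/

section Spectral

variable {n : Type}

/-- The tensor power of a matrix. -/
def tensorPower (k : ℕ) (M : Matrix n n ℂ) : Matrix (Fin k → n) (Fin k → n) ℂ :=
  Matrix.of fun x y => ∏ i, M (x i) (y i)

lemma tensorPower_conjTranspose (k : ℕ) (M : Matrix n n ℂ) :
    tensorPower k M.conjTranspose = (tensorPower k M).conjTranspose := by
  ext x y
  simp [tensorPower]

lemma tensorPower_diagonal [DecidableEq n] (k : ℕ) (l : n → ℂ) :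
    tensorPower k (Matrix.diagonal l) = Matrix.diagonal fun x => ∏ i, l (x i) := by
  ext x y
  simp only [tensorPower, Matrix.of_apply, Matrix.diagonal_apply]
  by_cases h : x = y
  · simp [h]
  · obtain ⟨i, hi⟩ := Function.ne_iff.1 h
    rw [if_neg h]
    exact Finset.prod_eq_zero (Finset.mem_univ i) (if_neg hi)

lemma tensorPower_one [DecidableEq n] (k : ℕ) : tensorPower k (1 : Matrix n n ℂ) = 1 := by
  rw [← Matrix.diagonal_one, tensorPower_diagonal]
  simp

lemma tensorPower_mul [Fintype n] (k : ℕ) (M N : Matrix n n ℂ) :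
    tensorPower k (M * N) = tensorPower k M * tensorPower k N := by
  ext x y
  simp only [tensorPower, Matrix.of_apply, Matrix.mul_apply, ← Finset.prod_mul_distrib,
    Fintype.prod_sum]

/-- The negative entropy of a weight function, in bits. -/
noncomputable def negEntropy [Fintype n] (l : n → ℝ) : ℝ := ∑ i, l i * Real.logb 2 (l i)

variable [Fintype n] [DecidableEq n]

/-- `V` and `l` diagonalise `M`. -/
def IsSpectral (M V : Matrix n n ℂ) (l : n → ℝ) : Prop :=
  IsUnitaryMap V ∧ M = V * Matrix.diagonal (fun i => (l i : ℂ)) * V.conjTranspose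

lemma IsSpectral.trace {M V : Matrix n n ℂ} {l : n → ℝ} (h : IsSpectral M V l) :
    M.trace = ∑ i, (l i : ℂ) := by
  rw [h.2, Matrix.trace_mul_comm, ← Matrix.mul_assoc, h.1.2, Matrix.one_mul, Matrix.trace_diagonal]

lemma exists_isSpectral {M : Matrix n n ℂ} (hM : M.PosSemidef) :
    ∃ (V : Matrix n n ℂ) (l : n → ℝ), IsSpectral M V l ∧ (∀ i, 0 ≤ l i) ∧
      vonNeumannEntropy M = -negEntropy l := by
  have hH := hM.1
  set V : Matrix n n ℂ := (hH.eigenvectorUnitary : Matrix n n ℂ) with hV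
  have hV1 : V * V.conjTranspose = 1 := Unitary.coe_mul_star_self hH.eigenvectorUnitary
  have hV2 : V.conjTranspose * V = 1 := Unitary.coe_star_mul_self hH.eigenvectorUnitary
  have hs : M = V * Matrix.diagonal (fun i => (hH.eigenvalues i : ℂ)) * V.conjTranspose := by
    have h := hH.spectral_theorem
    rw [Unitary.conjStarAlgAut_apply] at h
    exact h
  have hl : matrixLog M = V * Matrix.diagonal
      (fun i => (Real.logb 2 (hH.eigenvalues i) : ℂ)) * V.conjTranspose := by
    rw [matrixLog, hH.cfc_eq, Matrix.IsHermitian.cfc, Unitary.conjStarAlgAut_apply]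
    rfl
  refine ⟨V, hH.eigenvalues, ⟨⟨hV1, hV2⟩, hs⟩, hM.eigenvalues_nonneg, ?_⟩
  have hprod : M * matrixLog M = V * Matrix.diagonal (fun i =>
      ((hH.eigenvalues i * Real.logb 2 (hH.eigenvalues i) : ℝ) : ℂ)) * V.conjTranspose := by
    rw [hl]
    nth_rewrite 1 [hs]
    calc _ = V * (Matrix.diagonal (fun i => (hH.eigenvalues i : ℂ)) * (V.conjTranspose * V) *
          Matrix.diagonal (fun i => (Real.logb 2 (hH.eigenvalues i) : ℂ))) * V.conjTranspose := by
          simp only [Matrix.mul_assoc]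
      _ = _ := by
          rw [hV2, Matrix.mul_one, Matrix.diagonal_mul_diagonal]
          simp only [Complex.ofReal_mul]
  rw [vonNeumannEntropy, IsSpectral.trace ⟨⟨hV1, hV2⟩, hprod⟩, negEntropy, ← Complex.ofReal_sum,
    Complex.ofReal_re]

/-- Used for the second state, where `C₂` is transposed in place of `B`; the spectrum does not see
the difference. -/
lemma IsSpectral.transpose {M V : Matrix n n ℂ} {l : n → ℝ} (h : IsSpectral M V l) :
    IsSpectral M.transpose (V.map star) l := by
  refine ⟨isUnitaryMap_map_star h.1, ?_⟩
  rw [h.2, Matrix.transpose_mul, Matrix.transpose_mul, Matrix.diagonal_transpose, Matrix.mul_assoc]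
  congr 2
  ext i j
  simp

lemma IsSpectral.kronecker {m : Type} [Fintype m] [DecidableEq m] {M V : Matrix n n ℂ} {l : n → ℝ}
    {M' V' : Matrix m m ℂ} {l' : m → ℝ} (h : IsSpectral M V l) (h' : IsSpectral M' V' l') :
    IsSpectral (M ⊗ₖ M') (V ⊗ₖ V') fun i => l i.1 * l' i.2 := by
  refine ⟨isUnitaryMap_kronecker h.1 h'.1, ?_⟩
  rw [h.2, h'.2, Matrix.mul_kronecker_mul, Matrix.mul_kronecker_mul,
    Matrix.diagonal_kronecker_diagonal, Matrix.conjTranspose_kronecker]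
  simp only [Complex.ofReal_mul]

lemma IsSpectral.tensorPower {M V : Matrix n n ℂ} {l : n → ℝ} (h : IsSpectral M V l) (k : ℕ) :
    IsSpectral (tensorPower k M) (tensorPower k V) fun x => ∏ i, l (x i) := by
  refine ⟨⟨?_, ?_⟩, ?_⟩
  · rw [← tensorPower_conjTranspose, ← tensorPower_mul, h.1.1, tensorPower_one]
  · rw [← tensorPower_conjTranspose, ← tensorPower_mul, h.1.2, tensorPower_one]
  · rw [h.2, tensorPower_mul, tensorPower_mul, tensorPower_diagonal, tensorPower_conjTranspose]
    simp only [Complex.ofReal_prod]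

lemma IsSpectral.submatrix {m : Type} [Fintype m] [DecidableEq m] {M V : Matrix n n ℂ} {l : n → ℝ}
    (h : IsSpectral M V l) (e : m ≃ n) :
    IsSpectral (M.submatrix e e) (V.submatrix e e) (l ∘ e) := by
  refine ⟨⟨?_, ?_⟩, ?_⟩
  · rw [Matrix.conjTranspose_submatrix, Matrix.submatrix_mul_equiv, h.1.1,
      Matrix.submatrix_one_equiv]
  · rw [Matrix.conjTranspose_submatrix, Matrix.submatrix_mul_equiv, h.1.2,
      Matrix.submatrix_one_equiv]
  · have hd : Matrix.diagonal (fun i => (((l ∘ e) i : ℝ) : ℂ)) =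
        (Matrix.diagonal fun i => (l i : ℂ)).submatrix e e :=
      (Matrix.submatrix_diagonal_equiv (fun i => (l i : ℂ)) e).symm
    rw [hd, Matrix.conjTranspose_submatrix, Matrix.submatrix_mul_equiv, Matrix.submatrix_mul_equiv,
      ← h.2]

end Spectral

/-! ### Entropy of weights -/

section Weights

variable {n : Type} [Fintype n]

lemma negEntropy_mul {m : Type} [Fintype m] {l : n → ℝ} {l' : m → ℝ} (h : ∑ i, l i = 1)
    (h' : ∑ i, l' i = 1) :
    negEntropy (fun i : n × m => l i.1 * l' i.2) = negEntropy l + negEntropy l' := by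
  have key : ∀ i j, l i * l' j * Real.logb 2 (l i * l' j) =
      l i * Real.logb 2 (l i) * l' j + l i * (l' j * Real.logb 2 (l' j)) := by
    intro i j
    -- Zero weights are split off because the logarithm of a product needs nonzero factors.
    by_cases hi : l i = 0
    · simp [hi]
    by_cases hj : l' j = 0
    · simp [hj]
    rw [Real.logb_mul hi hj]
    ring
  simp only [negEntropy, Fintype.sum_prod_type, key, Finset.sum_add_distrib]
  simp only [← Finset.mul_sum, ← Finset.sum_mul, h, h', mul_one, one_mul]

lemma sum_prod_eq_one {l : n → ℝ} (h : ∑ i, l i = 1) (k : ℕ) :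
    ∑ x : Fin k → n, ∏ i, l (x i) = 1 := by
  classical
  rw [← Fintype.prod_sum fun (_ : Fin k) j => l j]
  simp [h]

lemma negEntropy_comp_equiv {m : Type} [Fintype m] (l : n → ℝ) (e : m ≃ n) :
    negEntropy (l ∘ e) = negEntropy l :=
  e.sum_comp fun i => l i * Real.logb 2 (l i)

lemma negEntropy_pow {l : n → ℝ} (h : ∑ i, l i = 1) (k : ℕ) :
    negEntropy (fun x : Fin k → n => ∏ i, l (x i)) = k * negEntropy l := by
  induction k with
  | zero => simp [negEntropy]
  | succ k ih =>
    have e := negEntropy_comp_equiv (fun x : Fin (k + 1) → n => ∏ i, l (x i))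
      (Fin.consEquiv fun _ => n)
    have e2 : ((fun x : Fin (k + 1) → n => ∏ i, l (x i)) ∘ Fin.consEquiv fun _ => n) =
        fun x : n × (Fin k → n) => l x.1 * ∏ i, l (x.2 i) := by
      funext x
      simp [Fin.prod_univ_succ, Fin.consEquiv]
    rw [← e, e2, negEntropy_mul h (sum_prod_eq_one h k), ih]
    push_cast
    ring

/-- Gibbs' inequality. -/
lemma sum_mul_logb_le_negEntropy {p w : n → ℝ} (hp : ∀ i, 0 ≤ p i) (hp1 : ∑ i, p i = 1)
    (hw : ∀ i, 0 < w i) (hw1 : ∑ i, w i ≤ 1) :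
    ∑ i, p i * Real.logb 2 (w i) ≤ negEntropy p := by
  -- This is `log x ≤ x - 1` at `x = w i / p i`, multiplied by `p i`. The corrections sum to at most
  -- zero, since `w` may be subnormalised.
  have key : ∀ i, p i * Real.log (w i) ≤ p i * Real.log (p i) + (w i - p i) := by
    intro i
    rcases (hp i).eq_or_lt with h | h
    · simp [← h, (hw i).le]
    · have h1 := Real.log_le_sub_one_of_pos (div_pos (hw i) h)
      rw [Real.log_div (hw i).ne' h.ne'] at h1
      have h2 := mul_le_mul_of_nonneg_left h1 h.le
      have h3 : p i * (w i / p i - 1) = w i - p i := by field_simp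
      linarith
  have hsum := Finset.sum_le_sum fun i (_ : i ∈ Finset.univ) => key i
  rw [Finset.sum_add_distrib, Finset.sum_sub_distrib] at hsum
  have h2 : 0 < Real.log 2 := Real.log_pos one_lt_two
  simp only [negEntropy, Real.logb, mul_div_assoc', ← Finset.sum_div]
  exact div_le_div_of_nonneg_right (by linarith) h2.le

/-- Bernoulli's inequality for exponents in `[0, 1]`: `x ^ q ≤ 1 + (x - 1) q ≤ 1 + x q`. -/
lemma mul_logb_le_logb_one_add {q x : ℝ} (hq : 0 ≤ q) (hq1 : q ≤ 1) (hx : 1 ≤ x) :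
    q * Real.logb 2 x ≤ Real.logb 2 (1 + x * q) := by
  have hx0 : 0 < x := by linarith
  rw [← Real.logb_rpow_eq_mul_logb_of_pos hx0]
  have h := rpow_one_add_le_one_add_mul_self (s := x - 1) (by linarith) hq hq1
  rw [add_sub_cancel] at h
  exact Real.logb_le_logb_of_le one_lt_two (Real.rpow_pos_of_pos hx0 q) (by nlinarith)

end Weights

/-- Converse bound for hypothesis testing against the maximally mixed state. -/
lemma hypothesisTest_le {n : Type} [Fintype n] [DecidableEq n] {σ V Q : Matrix n n ℂ} {p : n → ℝ}
    (hσ : IsSpectral σ V p) (hp : ∀ i, 0 ≤ p i) (hp1 : ∑ i, p i = 1) (hQ : IsEffect Q) {d δ : ℝ}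
    (hd : 1 ≤ d) (hQd : d * Q.trace.re ≤ Fintype.card n) (hδ : δ ≤ (Q * σ).trace.re) :
    δ * Real.logb 2 d - 1 ≤ Real.logb 2 (Fintype.card n) + negEntropy p := by
  have hn : Nonempty n := by
    by_contra h
    rw [not_nonempty_iff] at h
    simp at hp1
  set N : ℝ := (Fintype.card n : ℝ) with hN
  have hN0 : 0 < N := by rw [hN]; exact_mod_cast Fintype.card_pos
  -- In the eigenbasis of `σ` only the diagonal `q` of the test matters, and the problem becomes
  -- classical.
  set Q' := V.conjTranspose * Q * V with hQ'
  have hE : IsEffect Q' := hQ.conj hσ.1.2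
  set q : n → ℝ := fun i => (Q' i i).re with hq
  have hq0 : ∀ i, 0 ≤ q i := fun i => (Complex.le_def.1 (hE.1.diag_nonneg (i := i))).1
  have hq1 : ∀ i, q i ≤ 1 := fun i => by
    have h := (Complex.le_def.1 (hE.2.diag_nonneg (i := i))).1
    simp only [Complex.zero_re, Matrix.sub_apply, Matrix.one_apply_eq, Complex.sub_re,
      Complex.one_re] at h
    linarith
  have hqs : ∑ i, q i = Q.trace.re := by
    have h : Q'.trace = Q.trace := by
      rw [hQ', Matrix.trace_mul_comm, ← Matrix.mul_assoc, hσ.1.1, Matrix.one_mul]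
    rw [← h, Matrix.trace, Complex.re_sum]
    rfl
  have hpq : ∑ i, p i * q i = (Q * σ).trace.re := by
    have h : (Q * σ).trace = (Q' * Matrix.diagonal fun i => (p i : ℂ)).trace := by
      rw [hσ.2, ← Matrix.mul_assoc, Matrix.trace_mul_comm, hQ']
      simp only [Matrix.mul_assoc]
    rw [h, Matrix.trace, Complex.re_sum]
    refine Finset.sum_congr rfl fun i _ => ?_
    rw [Matrix.diag_apply, Matrix.mul_diagonal, Complex.re_mul_ofReal, mul_comm]
  have hpos : ∀ i, 0 < 1 + d * q i := fun i => by
    have := mul_nonneg (by linarith : (0 : ℝ) ≤ d) (hq0 i)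
    linarith
  -- The weights mix the uniform distribution with the test. Their numerators sum to `N + d Tr Q ≤ 2
  -- N`, whence the denominator; its factor 2 costs the one bit in the bound.
  have hG := sum_mul_logb_le_negEntropy (w := fun i => (1 + d * q i) / (2 * N)) hp hp1
    (fun i => div_pos (hpos i) (by positivity)) (by
      rw [← Finset.sum_div, Finset.sum_add_distrib, ← Finset.mul_sum, hqs, Finset.sum_const,
        Finset.card_univ, nsmul_eq_mul, ← hN, mul_one, div_le_one (by positivity)]
      linarith)
  have hterm : ∀ i, p i * (q i * Real.logb 2 d - 1 - Real.logb 2 N) ≤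
      p i * Real.logb 2 ((1 + d * q i) / (2 * N)) := by
    intro i
    refine mul_le_mul_of_nonneg_left ?_ (hp i)
    rw [Real.logb_div (hpos i).ne' (by positivity), Real.logb_mul two_ne_zero hN0.ne',
      Real.logb_self_eq_one one_lt_two]
    linarith [mul_logb_le_logb_one_add (hq0 i) (hq1 i) hd]
  have hsum := (Finset.sum_le_sum fun i (_ : i ∈ Finset.univ) => hterm i).trans hG
  have hlhs : ∑ i, p i * (q i * Real.logb 2 d - 1 - Real.logb 2 N) =
      (∑ i, p i * q i) * Real.logb 2 d - 1 - Real.logb 2 N := by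
    simp only [mul_sub, Finset.sum_sub_distrib, ← mul_assoc, ← Finset.sum_mul, hp1, one_mul,
      mul_one]
  rw [hlhs, hpq] at hsum
  have := mul_le_mul_of_nonneg_right hδ (Real.logb_nonneg one_lt_two hd)
  linarith

/-! ### The converse bound -/

lemma trace_partialTranspose {X Y : Type} [Fintype X] [Fintype Y] (ρ : Matrix (X × Y) (X × Y) ℂ) :
    (partialTranspose ρ).trace = ρ.trace := rfl

lemma card_ne_zero_of_isState {n : Type} [Fintype n] {ρ : Matrix n n ℂ} (h : IsState ρ) :
    Fintype.card n ≠ 0 := by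
  intro h0
  have := Fintype.card_eq_zero_iff.1 h0
  have h1 := h.2
  simp [Matrix.trace] at h1

/-- The second argument is a nonzero scalar matrix: its kernel is trivial and its logarithm is the
scalar `-log |n|`. -/
lemma relEntropy_maximallyMixed {n : Type} [Fintype n] [DecidableEq n] {ρ : Matrix n n ℂ}
    (hρ : IsState ρ) : relEntropy ρ (maximallyMixed n) = (globalPurity ρ : EReal) := by
  have hn := card_ne_zero_of_isState hρ
  have hker : LinearMap.ker (maximallyMixed n).toLin' ≤ LinearMap.ker ρ.toLin' := by
    intro v hv
    have hv0 : v = 0 := by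
      simpa [maximallyMixed, hn] using hv
    rw [hv0]
    exact zero_mem _
  have hlog : matrixLog (maximallyMixed n) =
      ((-Real.logb 2 (Fintype.card n) : ℝ) : ℂ) • (1 : Matrix n n ℂ) := by
    have e : maximallyMixed n = algebraMap ℝ (Matrix n n ℂ) (Fintype.card n : ℝ)⁻¹ := by
      ext i j
      simp [maximallyMixed, Matrix.algebraMap_matrix_apply, Matrix.one_apply]
    rw [matrixLog, e, cfc_algebraMap, Real.logb_inv]
    ext i j
    simp [Matrix.algebraMap_matrix_apply, Matrix.one_apply]
  rw [relEntropy, if_pos hker, hlog, Matrix.trace_sub, Matrix.mul_smul, Matrix.mul_one,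
    Matrix.trace_smul, hρ.2, globalPurity, vonNeumannEntropy]
  congr 1
  simp
  ring

section Converse

variable {A C₁ C₂ B : Type} [Fintype A] [Fintype C₁] [Fintype C₂] [Fintype B]
  [DecidableEq A] [DecidableEq C₁] [DecidableEq C₂] [DecidableEq B]

/-- Regrouping of `Aⁿ × (C₁C₂)ⁿ × Bⁿ` as `(AC₁C₂B)ⁿ`. -/
def copiesEquiv (A C₁ C₂ B : Type) (n : ℕ) :
    (Fin n → A) × (Fin n → C₁ × C₂) × (Fin n → B) ≃ (Fin n → (A × C₁) × (C₂ × B)) where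
  toFun x k := ((x.1 k, (x.2.1 k).1), ((x.2.1 k).2, x.2.2 k))
  invFun y := (fun k => (y k).1.1, fun k => ((y k).1.2, (y k).2.1), fun k => (y k).2.2)
  left_inv _ := rfl
  right_inv _ := rfl

/-- Transposing `C₂` rather than `B` gives the full transpose of the partial transpose of `ρ'`. -/
lemma transposeC_copies (ρ : Matrix (A × C₁) (A × C₁) ℂ) (ρ' : Matrix (C₂ × B) (C₂ × B) ℂ)
    (n : ℕ) : transposeC (copies ρ ρ' n) =
      (tensorPower n (partialTranspose ρ ⊗ₖ (partialTranspose ρ').transpose)).submatrix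
        (copiesEquiv A C₁ C₂ B n) (copiesEquiv A C₁ C₂ B n) := rfl

lemma exists_isSpectral_copies {ρ : Matrix (A × C₁) (A × C₁) ℂ} {ρ' : Matrix (C₂ × B) (C₂ × B) ℂ}
    (hρ : IsPPTState ρ) (hρ' : IsPPTState ρ') (n : ℕ) :
    ∃ V p, IsSpectral (transposeC (copies ρ ρ' n)) V p ∧ (∀ i, 0 ≤ p i) ∧ ∑ i, p i = 1 ∧
      Real.logb 2 (Fintype.card (copiesSystem A C₁ C₂ B n).Basis) + negEntropy p =
        n * (globalPurity (partialTranspose ρ) + globalPurity (partialTranspose ρ')) := by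
  obtain ⟨V, l, h, hl, hS⟩ := exists_isSpectral hρ.2
  obtain ⟨V', l', h', hl', hS'⟩ := exists_isSpectral hρ'.2
  have hl1 : ∑ i, l i = 1 := by
    have e := h.trace
    rw [trace_partialTranspose, hρ.1.2] at e
    exact_mod_cast e.symm
  have hl1' : ∑ i, l' i = 1 := by
    have e := h'.trace
    rw [trace_partialTranspose, hρ'.1.2] at e
    exact_mod_cast e.symm
  have hll : ∑ i : (A × C₁) × (C₂ × B), l i.1 * l' i.2 = 1 := by
    rw [Fintype.sum_prod_type]
    simp only [← Finset.mul_sum, hl1', mul_one, hl1]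
  let e := copiesEquiv A C₁ C₂ B n
  have hs := ((h.kronecker h'.transpose).tensorPower n).submatrix e
  rw [← transposeC_copies] at hs
  refine ⟨_, _, hs, fun i => Finset.prod_nonneg fun k _ => mul_nonneg (hl _) (hl' _), ?_, ?_⟩
  · rw [← sum_prod_eq_one hll n]
    exact e.sum_comp fun x : Fin n → (A × C₁) × (C₂ × B) => ∏ k, (l (x k).1 * l' (x k).2)
  · rw [negEntropy_comp_equiv, negEntropy_pow hll, negEntropy_mul hl1 hl1', Fintype.card_congr e,
      Fintype.card_fun, Fintype.card_fin, Fintype.card_prod, globalPurity, globalPurity, hS, hS',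
      Nat.cast_pow, Real.logb_pow, Nat.cast_mul, Real.logb_mul
        (by exact_mod_cast card_ne_zero_of_isState hρ.1)
        (by exact_mod_cast card_ne_zero_of_isState hρ'.1)]
    ring

lemma trace_re_le_card {n : Type} [Fintype n] [DecidableEq n] {Q : Matrix n n ℂ}
    (hQ : IsEffect Q) : Q.trace.re ≤ Fintype.card n := by
  have h := (Complex.le_def.1 hQ.2.trace_nonneg).1
  rw [Matrix.trace_sub, Matrix.trace_one, Complex.sub_re, Complex.natCast_re, Complex.zero_re] at h
  linarith

/-- The identity pulls back to an operator whose trace is the output dimension and whose partial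
transpose is an effect; the trace of an effect is at most the input dimension. -/
lemma HasPPTDual.card_le {S T : TripartiteSystem} {f : S.Op → T.Op} (hf : HasPPTDual S T f) :
    Fintype.card T.Basis ≤ Fintype.card S.Basis := by
  obtain ⟨Q, -, h1, h2⟩ := hf 1
  have h3 := trace_re_le_card (h2 (by rw [transposeC_one]; exact IsEffect.one))
  rw [trace_transposeC, h1, Matrix.trace_one, Complex.natCast_re] at h3
  exact_mod_cast h3

lemma CanDistill.mul_logb_le {ρ : Matrix (A × C₁) (A × C₁) ℂ} {ρ' : Matrix (C₂ × B) (C₂ × B) ℂ}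
    (hρ : IsPPTState ρ) (hρ' : IsPPTState ρ') {ε : ℝ} {n d : ℕ} (h : CanDistill ρ ρ' ε n d) :
    (1 - ε) * Real.logb 2 d ≤
      n * (globalPurity (partialTranspose ρ) + globalPurity (partialTranspose ρ')) + 1 := by
  obtain ⟨V, p, hs, hp, hp1, hG⟩ := exists_isSpectral_copies hρ hρ' n
  rcases Nat.eq_zero_or_pos d with rfl | hd
  -- For `d = 0` the convention `log 0 = 0` leaves `0 ≤ n G + 1` to prove; the trivial test `1`
  -- gives it.
  · have ht : (1 : ℝ) ≤ (1 * transposeC (copies ρ ρ' n)).trace.re := by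
      rw [Matrix.one_mul, hs.trace, ← Complex.ofReal_sum, hp1, Complex.ofReal_re]
    have h1 := hypothesisTest_le hs hp hp1 IsEffect.one le_rfl
      (by rw [one_mul]; exact trace_re_le_card IsEffect.one) ht
    rw [hG, Real.logb_one] at h1
    rw [Nat.cast_zero, Real.logb_zero]
    linarith
  obtain ⟨a, c, b, Λ, α, hΛ, hα, hε⟩ := h
  have := Fin.pos_iff_nonempty.1 hd
  obtain ⟨P, hP, hPP, hPt, hPα⟩ := hα.exists_projection
  obtain ⟨Q, hQ1, hQ2, hQ3⟩ := hΛ.hasPPTDual (extendC (Fin c) P)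
  have hE := hQ3 (by
    rw [transposeC_extendC]
    exact isEffect_extendC hP hPP)
  -- `P` accepts `α` with certainty, and replacing `α` by the actual output costs at most the trace
  -- distance `ε`.
  have htest : 1 - ε ≤ (transposeC Q * transposeC (copies ρ ρ' n)).trace.re := by
    have h1 := norm_trace_mul_le_traceNorm hP hPP (traceC (Λ (copies ρ ρ' n)) - α)
    have h2 : (transposeC Q * transposeC (copies ρ ρ' n)).trace =
        (P * (traceC (Λ (copies ρ ρ' n)) - α)).trace + 1 := by
      rw [trace_transposeC_mul_transposeC, ← hQ1, Matrix.mul_sub, Matrix.trace_sub, hPα,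
        trace_extendC_mul, sub_add_cancel]
    have h3 := (abs_le.1 (Complex.abs_re_le_norm
      (P * (traceC (Λ (copies ρ ρ' n)) - α)).trace)).1
    rw [h2, Complex.add_re, Complex.one_re]
    linarith
  -- The trace of `Q` is `c * (a * b)`, so multiplying by `d` gives the output dimension, which
  -- cannot exceed the input dimension.
  have hcard : (d : ℝ) * (transposeC Q).trace.re ≤
      Fintype.card (copiesSystem A C₁ C₂ B n).Basis := by
    have h1 := hΛ.hasPPTDual.card_le
    have h2 : (d : ℝ) * (transposeC Q).trace.re = Fintype.card
        (⟨Fin d × Fin a, Fin c, Fin b⟩ : TripartiteSystem).Basis := by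
      have h3 : Q.trace = ((c * (a * b) : ℕ) : ℂ) := by
        rw [hQ2]
        refine (trace_extendC P).trans ?_
        rw [hPt]
        simp
      rw [trace_transposeC, h3, Complex.natCast_re]
      simp
      ring
    rw [h2]
    exact_mod_cast h1
  have h1 := hypothesisTest_le hs hp hp1 hE (by exact_mod_cast hd) hcard htest
  linarith

/-- The rate is an infimum over `ε`, so one fixed `ε` bounds it. The additive bit vanishes on
division by `n`, while the factor `1 / (1 - ε)` survives until `ε → 0`. -/
lemma repeatedRandomnessRate_le_div {ρ : Matrix (A × C₁) (A × C₁) ℂ}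
    {ρ' : Matrix (C₂ × B) (C₂ × B) ℂ} (hρ : IsPPTState ρ) (hρ' : IsPPTState ρ') {ε : ℝ}
    (hε : 0 < ε) (hε1 : ε < 1) :
    repeatedRandomnessRate ρ ρ' ≤ (((globalPurity (partialTranspose ρ) +
      globalPurity (partialTranspose ρ')) / (1 - ε) : ℝ) : EReal) := by
  set G := globalPurity (partialTranspose ρ) + globalPurity (partialTranspose ρ') with hG
  refine (iInf₂_le ε hε).trans ?_
  have hlim : Tendsto (fun n : ℕ => (((G + 1 / n) / (1 - ε) : ℝ) : EReal)) atTop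
      (𝓝 ((G / (1 - ε) : ℝ) : EReal)) := by
    refine (continuous_coe_real_ereal.tendsto _).comp ?_
    have h := (tendsto_one_div_atTop_nhds_zero_nat (𝕜 := ℝ)).const_add G
    rw [add_zero] at h
    exact h.div_const _
  rw [← hlim.limsup_eq]
  refine limsup_le_limsup ?_
  filter_upwards [eventually_ge_atTop 1] with n hn
  refine iSup₂_le fun d hd => ?_
  have hn0 : (0 : ℝ) < n := by exact_mod_cast hn
  have h := hd.mul_logb_le hρ hρ'
  rw [EReal.coe_le_coe_iff, le_div_iff₀ (by linarith), div_mul_eq_mul_div, div_le_iff₀ hn0]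
  have e : (G + 1 / n) * n = n * G + 1 := by field_simp
  rw [e]
  linarith

lemma repeatedRandomnessRate_le {ρ : Matrix (A × C₁) (A × C₁) ℂ}
    {ρ' : Matrix (C₂ × B) (C₂ × B) ℂ} (hρ : IsPPTState ρ) (hρ' : IsPPTState ρ') :
    repeatedRandomnessRate ρ ρ' ≤ ((globalPurity (partialTranspose ρ) +
      globalPurity (partialTranspose ρ') : ℝ) : EReal) := by
  set G := globalPurity (partialTranspose ρ) + globalPurity (partialTranspose ρ') with hG
  have hlim : Tendsto (fun ε : ℝ => ((G / (1 - ε) : ℝ) : EReal)) (𝓝[>] 0) (𝓝 (G : EReal)) := by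
    refine (continuous_coe_real_ereal.tendsto _).comp ?_
    have h : ContinuousAt (fun ε : ℝ => G / (1 - ε)) 0 :=
      continuousAt_const.div (continuousAt_const.sub continuousAt_id) (by simp)
    have h2 := h.tendsto.mono_left (nhdsWithin_le_nhds (s := Set.Ioi 0))
    simpa using h2
  refine ge_of_tendsto hlim ?_
  filter_upwards [Ioo_mem_nhdsGT (zero_lt_one' ℝ)] with ε hε
  exact repeatedRandomnessRate_le_div hρ hρ' hε.1 hε.2

end Converse

end PrivateRandomness

theorem mainTheorem1 {A C₁ C₂ B : Type}
    [Fintype A] [Fintype C₁] [Fintype C₂] [Fintype B]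
    [DecidableEq A] [DecidableEq C₁] [DecidableEq C₂] [DecidableEq B]
    (ρ : Matrix (A × C₁) (A × C₁) ℂ) (ρ' : Matrix (C₂ × B) (C₂ × B) ℂ)
    (hρ : PrivateRandomness.IsPPTState ρ) (hρ' : PrivateRandomness.IsPPTState ρ') :
    PrivateRandomness.repeatedRandomnessRate ρ ρ' ≤
        PrivateRandomness.relEntropy (PrivateRandomness.partialTranspose ρ)
            (PrivateRandomness.maximallyMixed (A × C₁)) +
          PrivateRandomness.relEntropy (PrivateRandomness.partialTranspose ρ')
            (PrivateRandomness.maximallyMixed (C₂ × B)) ∧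
      PrivateRandomness.repeatedRandomnessRate ρ ρ' ≤
        ((PrivateRandomness.globalPurity (PrivateRandomness.partialTranspose ρ) +
          PrivateRandomness.globalPurity (PrivateRandomness.partialTranspose ρ') : ℝ) : EReal) ∧
      PrivateRandomness.relEntropy (PrivateRandomness.partialTranspose ρ)
            (PrivateRandomness.maximallyMixed (A × C₁)) +
          PrivateRandomness.relEntropy (PrivateRandomness.partialTranspose ρ')
            (PrivateRandomness.maximallyMixed (C₂ × B)) =
        ((PrivateRandomness.globalPurity (PrivateRandomness.partialTranspose ρ) +
          PrivateRandomness.globalPurity (PrivateRandomness.partialTranspose ρ') : ℝ) : EReal) := by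
  -- Positivity is the PPT hypothesis; partial transposition leaves the diagonal, hence the trace,
  -- unchanged.
  have hpt : ∀ {X Y : Type} [Fintype X] [Fintype Y] [DecidableEq X] [DecidableEq Y]
      {τ : Matrix (X × Y) (X × Y) ℂ}, PrivateRandomness.IsPPTState τ →
      PrivateRandomness.IsState (PrivateRandomness.partialTranspose τ) :=
    fun h => ⟨h.2, h.1.2⟩
  rw [PrivateRandomness.relEntropy_maximallyMixed (hpt hρ),
    PrivateRandomness.relEntropy_maximallyMixed (hpt hρ'), ← EReal.coe_add]
  exact ⟨PrivateRandomness.repeatedRandomnessRate_le hρ hρ',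
    PrivateRandomness.repeatedRandomnessRate_le hρ hρ', rfl⟩
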